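/- For $n\ge 0$ and $\sigma\in\mathfrak S_n$ let the norm $N(\sigma)$ be the least number of transpositions whose product is $\sigma$. Let $\mathrm{gr}^N\mathbb Q[\mathfrak S_n]$ be the associated graded algebra of the group algebra with respect to the norm filtration: the $\mathbb Q$-algebra with basis $\{[\sigma] : \sigma\in\mathfrak S_n\}$ and product $[\sigma][\tau]=[\sigma\tau]$ if $N(\sigma\tau)=N(\sigma)+N(\tau)$, and $[\sigma][\tau]=0$ otherwise. Let $\mathcal A(n)\subseteq \mathrm{gr}^N\mathbb Q[\mathfrak S_n]$ be the subalgebra of elements invariant under conjugation by $\mathfrak S_n$, and let $\mathcal A(n)_{\le k}$ be the subspace of the elements of $\mathcal A(n)$ that are linear combinations of basis elements $[\sigma]$ with $N(\sigma)\le k$. Let $\delta_i(n)\in\mathcal A(n)$ be the sum of all $[\sigma]$ where $\sigma$ ranges over the products of $i$ pairwise disjoint transpositions. Proposition. Let $d\ge 1$ and $h=2d$. The elements $\delta_1(h),\delta_2(h),\dots,\delta_{d-1}(h)$ generate $\mathcal A(h)_{\le d-1}$; that is, they lie in $\mathcal A(h)_{\le d-1}$, and every element of $\mathcal A(h)_{\le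 d-1}$ lies in the $\mathbb Q$-subalgebra of $\mathcal A(h)$ generated by $\delta_1(h),\dots,\delta_{d-1}(h)$. -/

import Mathlib

noncomputable section

namespace NormGraded

open Equiv Finset

/-- The norm `N σ` of a permutation: the least number of transpositions whose product is `σ`. -/
def N {n : ℕ} (σ : Perm (Fin n)) : ℕ :=
  sInf {k : ℕ | ∃ l : List (Perm (Fin n)), (∀ t ∈ l, t.IsSwap) ∧ l.prod = σ ∧ l.length = k}

theorem exists_factors {n : ℕ} (σ : Perm (Fin n)) :
    ∃ l : List (Perm (Fin n)), (∀ t ∈ l, t.IsSwap) ∧ l.prod = σ ∧ l.length = N σ := by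
  have h : {k : ℕ | ∃ l : List (Perm (Fin n)),
      (∀ t ∈ l, t.IsSwap) ∧ l.prod = σ ∧ l.length = k}.Nonempty := by
    obtain ⟨l, h1, h2⟩ := (Perm.truncSwapFactors σ).out
    exact ⟨l.length, l, h2, h1, rfl⟩
  exact Nat.sInf_mem h

theorem N_le {n : ℕ} {σ : Perm (Fin n)} (l : List (Perm (Fin n)))
    (hl : ∀ t ∈ l, t.IsSwap) (hp : l.prod = σ) : N σ ≤ l.length :=
  Nat.sInf_le ⟨l, hl, hp, rfl⟩

theorem N_one {n : ℕ} : N (1 : Perm (Fin n)) = 0 :=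
  Nat.le_zero.mp (N_le [] (by simp) (by simp))

theorem N_mul_le {n : ℕ} (σ τ : Perm (Fin n)) : N (σ * τ) ≤ N σ + N τ := by
  obtain ⟨l, h1, h2, h3⟩ := exists_factors σ
  obtain ⟨m, k1, k2, k3⟩ := exists_factors τ
  have := N_le (σ := σ * τ) (l ++ m)
    (by
      intro t ht
      rcases List.mem_append.mp ht with ht | ht
      · exact h1 t ht
      · exact k1 t ht)
    (by rw [List.prod_append, h2, k2])
  rw [List.length_append, h3, k3] at this
  exact this

theorem N_conj_le {n : ℕ} (g σ : Perm (Fin n)) : N (g * σ * g⁻¹) ≤ N σ := by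
  obtain ⟨l, h1, h2, h3⟩ := exists_factors σ
  have := N_le (σ := g * σ * g⁻¹) (l.map (MulAut.conj g))
    (by
      intro t ht
      obtain ⟨s, hs, rfl⟩ := List.mem_map.mp ht
      obtain ⟨x, y, hxy, rfl⟩ := h1 s hs
      refine ⟨g x, g y, fun h => hxy (g.injective h), ?_⟩
      rw [MulAut.conj_apply, Equiv.swap_apply_apply])
    (by rw [List.prod_hom, h2, MulAut.conj_apply])
  rw [List.length_map, h3] at this
  exact this

theorem N_conj {n : ℕ} (g σ : Perm (Fin n)) : N (g * σ * g⁻¹) = N σ := by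
  refine le_antisymm (N_conj_le g σ) ?_
  have := N_conj_le g⁻¹ (g * σ * g⁻¹)
  simpa [mul_assoc] using this

/-- The associated graded algebra of `ℚ[𝔖ₙ]` with respect to the norm filtration: its elements
are the formal rational combinations `∑ a σ • [σ]`, and `[σ] * [τ]` is `[σ τ]` if
`N (σ τ) = N σ + N τ` and `0` otherwise (see `of_mul_of`). -/
def Gr (n : ℕ) : Type := Perm (Fin n) → ℚ

namespace Gr

variable {n : ℕ}

instance : AddCommGroup (Gr n) := inferInstanceAs (AddCommGroup (Perm (Fin n) → ℚ))
instance : Module ℚ (Gr n) := inferInstanceAs (Module ℚ (Perm (Fin n) → ℚ))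

/-- The coefficient of `[σ]`. -/
def coeff (a : Gr n) (σ : Perm (Fin n)) : ℚ := a σ

@[ext] theorem ext {a b : Gr n} (h : ∀ σ, a.coeff σ = b.coeff σ) : a = b := funext h

@[simp] theorem coeff_add (a b : Gr n) (σ : Perm (Fin n)) :
    (a + b).coeff σ = a.coeff σ + b.coeff σ := rfl
@[simp] theorem coeff_zero (σ : Perm (Fin n)) : (0 : Gr n).coeff σ = 0 := rfl
@[simp] theorem coeff_smul (c : ℚ) (a : Gr n) (σ : Perm (Fin n)) :
    (c • a).coeff σ = c * a.coeff σ := rfl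

theorem coeff_sum {ι : Type*} (s : Finset ι) (f : ι → Gr n) (σ : Perm (Fin n)) :
    (∑ i ∈ s, f i).coeff σ = ∑ i ∈ s, (f i).coeff σ :=
  map_sum (⟨⟨fun a : Gr n => a.coeff σ, rfl⟩, fun _ _ => rfl⟩ : Gr n →+ ℚ) f s

/-- The basis element `[σ]`. -/
def of (σ : Perm (Fin n)) : Gr n := fun τ => if τ = σ then 1 else 0

theorem coeff_of (σ τ : Perm (Fin n)) : (of σ).coeff τ = if τ = σ then 1 else 0 := rfl

instance : One (Gr n) := ⟨of 1⟩

instance : Mul (Gr n) :=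
  ⟨fun a b ρ => ∑ σ : Perm (Fin n),
    if N σ + N (σ⁻¹ * ρ) = N ρ then a.coeff σ * b.coeff (σ⁻¹ * ρ) else 0⟩

theorem coeff_one (σ : Perm (Fin n)) : (1 : Gr n).coeff σ = if σ = 1 then 1 else 0 := rfl

theorem coeff_mul (a b : Gr n) (ρ : Perm (Fin n)) :
    (a * b).coeff ρ = ∑ σ : Perm (Fin n),
      if N σ + N (σ⁻¹ * ρ) = N ρ then a.coeff σ * b.coeff (σ⁻¹ * ρ) else 0 := rfl

theorem of_mul_of (σ τ : Perm (Fin n)) :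
    of σ * of τ = if N (σ * τ) = N σ + N τ then of (σ * τ) else 0 := by
  ext ρ
  rw [coeff_mul, Finset.sum_eq_single σ]
  · by_cases h : ρ = σ * τ
    · subst h
      by_cases h' : N (σ * τ) = N σ + N τ
      · simp [coeff_of, h']
      · have h'' : ¬ (N σ + N τ = N (σ * τ)) := fun e => h' e.symm
        simp [h', h'']
    · have h1 : σ⁻¹ * ρ ≠ τ := fun e => h (by rw [← e]; simp)
      split_ifs <;> simp [coeff_of, h, h1]
  · intro π _ hπ
    simp [coeff_of, hπ]
  · simp

protected theorem mul_assoc' (a b c : Gr n) : a * b * c = a * (b * c) := by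
  ext ρ
  have h1 : (a * b * c).coeff ρ = ∑ σ : Perm (Fin n), ∑ π : Perm (Fin n),
      if N π + N (π⁻¹ * σ) + N (σ⁻¹ * ρ) = N ρ then
        a.coeff π * b.coeff (π⁻¹ * σ) * c.coeff (σ⁻¹ * ρ) else 0 := by
    rw [coeff_mul]
    refine Finset.sum_congr rfl fun σ _ => ?_
    have e2 := N_mul_le σ (σ⁻¹ * ρ)
    rw [mul_inv_cancel_left] at e2
    split_ifs with h
    · rw [coeff_mul, Finset.sum_mul]
      refine Finset.sum_congr rfl fun π _ => ?_
      rw [ite_mul, zero_mul]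
      exact if_congr (by omega) rfl rfl
    · symm
      refine Finset.sum_eq_zero fun π _ => ?_
      have e1 := N_mul_le π (π⁻¹ * σ)
      rw [mul_inv_cancel_left] at e1
      exact if_neg (by omega)
  have h2 : (a * (b * c)).coeff ρ = ∑ π : Perm (Fin n), ∑ τ : Perm (Fin n),
      if N π + N τ + N (τ⁻¹ * (π⁻¹ * ρ)) = N ρ then
        a.coeff π * b.coeff τ * c.coeff (τ⁻¹ * (π⁻¹ * ρ)) else 0 := by
    rw [coeff_mul]
    refine Finset.sum_congr rfl fun π _ => ?_
    have e1 := N_mul_le π (π⁻¹ * ρ)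
    rw [mul_inv_cancel_left] at e1
    split_ifs with h
    · rw [coeff_mul, Finset.mul_sum]
      refine Finset.sum_congr rfl fun τ _ => ?_
      rw [mul_ite, mul_zero, mul_assoc]
      exact if_congr (by omega) rfl rfl
    · symm
      refine Finset.sum_eq_zero fun τ _ => ?_
      have e2 := N_mul_le τ (τ⁻¹ * (π⁻¹ * ρ))
      rw [mul_inv_cancel_left] at e2
      exact if_neg (by omega)
  rw [h1, h2, Finset.sum_comm]
  refine Finset.sum_congr rfl fun π _ => ?_
  rw [← Equiv.sum_comp (Equiv.mulLeft π)]
  refine Finset.sum_congr rfl fun τ _ => ?_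
  simp only [Equiv.coe_mulLeft, inv_mul_cancel_left, mul_inv_rev, mul_assoc]

instance : Ring (Gr n) where
  __ := (inferInstance : AddCommGroup (Gr n))
  mul_assoc := Gr.mul_assoc'
  one_mul a := by
    ext ρ
    rw [coeff_mul, Finset.sum_eq_single 1]
    · simp [coeff_one, N_one]
    · intro σ _ h
      simp [coeff_one, h]
    · simp
  mul_one a := by
    ext ρ
    rw [coeff_mul, Finset.sum_eq_single ρ]
    · simp [coeff_one, N_one]
    · intro σ _ h
      have h' : σ⁻¹ * ρ ≠ 1 := fun e => h (by simpa using (inv_mul_eq_one.mp e))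
      simp [coeff_one, h']
    · simp
  left_distrib a b c := by
    ext ρ
    simp only [coeff_mul, coeff_add, mul_add, ← Finset.sum_add_distrib]
    refine Finset.sum_congr rfl fun σ _ => ?_
    split_ifs <;> simp
  right_distrib a b c := by
    ext ρ
    simp only [coeff_mul, coeff_add, add_mul, ← Finset.sum_add_distrib]
    refine Finset.sum_congr rfl fun σ _ => ?_
    split_ifs <;> simp
  zero_mul a := by
    ext ρ
    simp [coeff_mul]
  mul_zero a := by
    ext ρ
    simp [coeff_mul]

instance : Algebra ℚ (Gr n) :=
  Algebra.ofModule
    (fun c a b => by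
      ext ρ
      simp only [coeff_mul, coeff_smul, Finset.mul_sum]
      refine Finset.sum_congr rfl fun σ _ => ?_
      split_ifs <;> simp [mul_assoc])
    (fun c a b => by
      ext ρ
      simp only [coeff_mul, coeff_smul, Finset.mul_sum]
      refine Finset.sum_congr rfl fun σ _ => ?_
      split_ifs <;> simp [mul_left_comm])

end Gr

/-- `A n`: the subalgebra of `Gr n` of the elements that are invariant under conjugation
by `𝔖ₙ`. -/
def A (n : ℕ) : Subalgebra ℚ (Gr n) where
  carrier := {a | ∀ g σ : Perm (Fin n), a.coeff (g * σ * g⁻¹) = a.coeff σ}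
  mul_mem' {a b} ha hb g ρ := by
    rw [Gr.coeff_mul, Gr.coeff_mul, ← Equiv.sum_comp (MulAut.conj g).toEquiv]
    refine Finset.sum_congr rfl fun σ _ => ?_
    have e : (g * σ * g⁻¹)⁻¹ * (g * ρ * g⁻¹) = g * (σ⁻¹ * ρ) * g⁻¹ := by group
    change (if N (g * σ * g⁻¹) + N ((g * σ * g⁻¹)⁻¹ * (g * ρ * g⁻¹)) = N (g * ρ * g⁻¹) then
      a.coeff (g * σ * g⁻¹) * b.coeff ((g * σ * g⁻¹)⁻¹ * (g * ρ * g⁻¹)) else 0) = _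
    rw [e, ha g σ, hb g (σ⁻¹ * ρ)]
    exact if_congr (by rw [N_conj, N_conj, N_conj]) rfl rfl
  add_mem' {a b} ha hb g σ := by
    rw [Gr.coeff_add, Gr.coeff_add, ha g σ, hb g σ]
  algebraMap_mem' c g σ := by
    rw [Algebra.algebraMap_eq_smul_one, Gr.coeff_smul, Gr.coeff_smul, Gr.coeff_one,
      Gr.coeff_one]
    simp only [conj_eq_one_iff]

/-- The part of `A n` of norm at most `k`: the elements of `A n` that are combinations of basis
elements `[σ]` with `N σ ≤ k`. -/
def normLE (n k : ℕ) : Submodule ℚ (A n) where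
  carrier := {a | ∀ σ : Perm (Fin n), (a : Gr n).coeff σ ≠ 0 → N σ ≤ k}
  zero_mem' σ h := absurd rfl h
  add_mem' {a b} ha hb σ h := by
    by_cases h1 : (a : Gr n).coeff σ = 0
    · refine hb σ fun h2 => h ?_
      change (a : Gr n).coeff σ + (b : Gr n).coeff σ = 0
      rw [h1, h2, add_zero]
    · exact ha σ h1
  smul_mem' c a ha σ h := by
    refine ha σ fun h1 => h ?_
    change c * (a : Gr n).coeff σ = 0
    rw [h1, mul_zero]

/-- `δ n i`: the sum of all `[σ]` where `σ` is a product of `i` disjoint transpositions. -/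
def δ (n i : ℕ) : A n :=
  ⟨∑ σ : Perm (Fin n) with σ.cycleType = Multiset.replicate i 2, Gr.of σ, by
    have hc : ∀ τ : Perm (Fin n),
        (∑ σ : Perm (Fin n) with σ.cycleType = Multiset.replicate i 2, Gr.of σ).coeff τ =
          if τ.cycleType = Multiset.replicate i 2 then 1 else 0 := by
      intro τ
      rw [Gr.coeff_sum]
      simp only [Gr.coeff_of]
      simp
    intro g σ
    rw [hc, hc, Perm.cycleType_conj]⟩

end NormGraded

end

/-!
# Generators of the invariant part of the graded group algebra

Call an invariant homogeneous element of norm `k` decomposable if it is a combination of products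
of the sum of all cycles of some length `i + 1` with invariant elements of norm `k - i`, where
`0 < i < k`; the subspace of these is `decomposables n k`. By induction on `k`, the
subalgebra generated by `δ₁, …, δ_k` contains all invariant elements of norm `k` once two facts are
known.

* Up to decomposables, the invariant elements of norm `k` are spanned by the sum of all cycles of
  length `k + 1`. Indeed, if `σ` is the disjoint product of a cycle `τ` and of `ρ ≠ 1`, then the
  product of the class sums of `τ` and `ρ` is a positive multiple of the class sum of `σ`, plus
  class sums of permutations of the same norm with smaller support (`classSum_mem_sup`).
* `δ_k` is not decomposable, if `2 * k ≤ n`. This is seen from a linear functional, `weightSum`,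
  that vanishes on decomposables but not on `δ_k`. Its value at `[σ]` is
  `± (product of the cycle lengths) * (n - f - 1)! * f!`, where `f` is the number of fixed points
  and the sign is `-1` to the number of nontrivial cycles. The values at the `σ` occurring in `δ_k`
  all have the same sign.

By the definition of decomposables, it is enough that `weightSum` vanishes on the product of the
sum of all cycles of length `i + 1` with `[σ]`, where `i ≥ 1`, `σ ≠ 1` and `2 * (i + N σ) ≤ n`
(`weightSum_cycleSum_mul_of`). A cycle through `x` is a product of transpositions along a walk that
starts at `x`, so its product with `[σ]` is obtained by successive multiplications with
transpositions, and such a multiplication either joins two cycles or gives `0`. With the weight `markedWeight σ x`, in which `x` is not counted as a fixed point, the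
sum of the weights over all ways to join the cycle of `x` to another one is `N σ + 2` times the
weight of `(σ, x)` (`sum_weight_swap_mul`). All steps of the walk together therefore contribute a
factor that depends only on `i` and `N σ`, and the remaining sum of `markedWeight σ x` over all `x`
is zero (`sum_markedWeight`).
-/

noncomputable section

namespace NormGraded

open Equiv Finset

/-! ### Cycles of permutations -/

section Orbits

/-- A relation that is reflexive and transitive and contains all pairs `(u, σ u)` contains
`σ.SameCycle`. -/
theorem sameCycle_induction {α : Type*} [Finite α] {σ : Perm α} {u v : α}
    {r : α → α → Prop} (hr : ∀ u, r u u)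
    (ht : ∀ u v w, r u v → r v w → r u w) (h : ∀ u, r u (σ u)) (huv : σ.SameCycle u v) :
    r u v := by
  obtain ⟨i, _, rfl⟩ := huv.exists_pow_eq'
  clear huv
  induction i with
  | zero => exact hr u
  | succ i ih =>
    rw [pow_succ', Perm.mul_apply]
    exact ht _ _ _ (ih (by omega)) (h _)

theorem not_sameCycle_of_apply_eq_self {α : Type*} {σ : Perm α} {x y : α}
    (hx : σ x = x) (hxy : x ≠ y) :
    ¬ σ.SameCycle x y := by
  rintro ⟨i, hi⟩
  rw [Perm.zpow_apply_eq_self_of_apply_eq_self hx] at hi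
  exact hxy hi

variable {α : Type*} [Fintype α] [DecidableEq α]

/-- The cycle of `σ` through `x`, as a set of points; a fixed point is a cycle of length one. -/
def orbit (σ : Perm α) (x : α) : Finset α := {z | σ.SameCycle x z}

/-- The set of all cycles of `σ`, fixed points included. -/
def cycles (σ : Perm α) : Finset (Finset α) := univ.image (orbit σ)

variable {σ : Perm α} {x y u v : α}

@[simp] theorem mem_orbit : v ∈ orbit σ u ↔ σ.SameCycle u v := by simp [orbit]

theorem self_mem_orbit (σ : Perm α) (x : α) : x ∈ orbit σ x := by simp [Perm.SameCycle.refl]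

theorem orbit_eq_iff : orbit σ u = orbit σ v ↔ σ.SameCycle u v := by
  constructor
  · intro h
    have := self_mem_orbit σ v
    rwa [← h, mem_orbit] at this
  · intro h
    ext z
    simp only [mem_orbit]
    exact ⟨fun h' => h.symm.trans h', fun h' => h.trans h'⟩

theorem card_orbit_pos (σ : Perm α) (x : α) : 0 < #(orbit σ x) :=
  card_pos.mpr ⟨x, self_mem_orbit σ x⟩

theorem card_orbit_eq_one (h : σ x = x) : #(orbit σ x) = 1 := by
  rw [card_eq_one]
  refine ⟨x, ?_⟩
  ext z
  rw [mem_orbit, mem_singleton]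
  constructor
  · rintro ⟨i, rfl⟩
    exact Perm.zpow_apply_eq_self_of_apply_eq_self h i
  · rintro rfl
    exact Perm.SameCycle.refl _ _

theorem two_le_card_orbit (h : σ x ≠ x) : 2 ≤ #(orbit σ x) := by
  have h2 : ({x, σ x} : Finset α) ⊆ orbit σ x := by
    intro z hz
    rw [mem_insert, mem_singleton] at hz
    rw [mem_orbit]
    rcases hz with rfl | rfl
    · exact Perm.SameCycle.refl _ _
    · exact ⟨1, by simp⟩
  have := card_le_card h2
  rwa [card_pair (Ne.symm h)] at this

/-- Multiplication by `swap x y` does not disconnect anything, provided it leaves `x` and `y`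
connected. -/
theorem sameCycle_swap_mul_of_sameCycle (h : (swap x y * σ).SameCycle x y)
    (huv : σ.SameCycle u v) : (swap x y * σ).SameCycle u v := by
  refine sameCycle_induction (r := (swap x y * σ).SameCycle) (Perm.SameCycle.refl _)
    (fun _ _ _ => Perm.SameCycle.trans) (fun w => ?_) huv
  have h1 : (swap x y * σ).SameCycle w (swap x y (σ w)) := ⟨1, by simp⟩
  rcases eq_or_ne (σ w) x with h2 | h2
  · rw [h2, swap_apply_left] at h1
    rw [h2]
    exact h1.trans h.symm
  rcases eq_or_ne (σ w) y with h3 | h3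
  · rw [h3, swap_apply_right] at h1
    rw [h3]
    exact h1.trans h
  · rwa [swap_apply_of_ne_of_ne h2 h3] at h1

/-- If `x` and `y` lie in different cycles of `σ`, then `swap x y` joins these cycles. -/
theorem sameCycle_swap_mul (h : ¬ σ.SameCycle x y) : (swap x y * σ).SameCycle x y := by
  -- The part of the `σ`-cycle of `x` that is connected to `x` under `swap x y * σ` is closed
  -- under `σ`, so it contains `σ⁻¹ x`, which `swap x y * σ` sends to `y`.
  have key : ∀ z, σ.SameCycle x z → (swap x y * σ).SameCycle x z := by
    intro z hz
    have := sameCycle_induction (σ := σ) (u := x) (v := z)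
      (r := fun u v => (σ.SameCycle x u ∧ (swap x y * σ).SameCycle x u) →
        (σ.SameCycle x v ∧ (swap x y * σ).SameCycle x v))
      (fun _ h => h) (fun _ _ _ h1 h2 h3 => h2 (h1 h3)) ?_ hz
    · exact (this ⟨Perm.SameCycle.refl _ _, Perm.SameCycle.refl _ _⟩).2
    · rintro u ⟨h1, h2⟩
      have h3 : σ.SameCycle x (σ u) := h1.trans ⟨1, by simp⟩
      refine ⟨h3, ?_⟩
      rcases eq_or_ne (σ u) x with h4 | h4
      · rw [h4]
      · have h5 : σ u ≠ y := fun e => h (e ▸ h3)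
        refine h2.trans ⟨1, ?_⟩
        simp [swap_apply_of_ne_of_ne h4 h5]
  refine (key (σ⁻¹ x) ⟨-1, by simp⟩).trans ⟨1, by simp⟩

theorem sameCycle_swap_mul_iff (h : ¬ σ.SameCycle x y) :
    (swap x y * σ).SameCycle u v ↔ σ.SameCycle u v ∨
      ((σ.SameCycle x u ∨ σ.SameCycle y u) ∧ (σ.SameCycle x v ∨ σ.SameCycle y v)) := by
  have hxy := sameCycle_swap_mul h
  have up : ∀ {a b}, σ.SameCycle a b → (swap x y * σ).SameCycle a b :=
    sameCycle_swap_mul_of_sameCycle hxy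
  constructor
  · intro huv
    refine sameCycle_induction (σ := swap x y * σ) (r := fun u v => σ.SameCycle u v ∨
      ((σ.SameCycle x u ∨ σ.SameCycle y u) ∧ (σ.SameCycle x v ∨ σ.SameCycle y v)))
      (fun u => Or.inl (Perm.SameCycle.refl _ _)) ?_ ?_ huv
    · rintro a b c (h1 | ⟨h1, h2⟩) (h3 | ⟨h3, h4⟩)
      · exact Or.inl (h1.trans h3)
      · exact Or.inr ⟨h3.imp (fun h => h.trans h1.symm) (fun h => h.trans h1.symm), h4⟩
      · exact Or.inr ⟨h1, h2.imp (fun h => h.trans h3) (fun h => h.trans h3)⟩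
      · exact Or.inr ⟨h1, h4⟩
    · intro w
      have hw : σ.SameCycle (σ w) w := ⟨-1, by simp⟩
      rw [Perm.mul_apply]
      rcases eq_or_ne (σ w) x with h2 | h2
      · rw [h2, swap_apply_left]
        exact Or.inr ⟨Or.inl (h2 ▸ hw), Or.inr (Perm.SameCycle.refl _ _)⟩
      rcases eq_or_ne (σ w) y with h3 | h3
      · rw [h3, swap_apply_right]
        exact Or.inr ⟨Or.inr (h3 ▸ hw), Or.inl (Perm.SameCycle.refl _ _)⟩
      · rw [swap_apply_of_ne_of_ne h2 h3]
        exact Or.inl hw.symm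
  · rintro (h1 | ⟨h1, h2⟩)
    · exact up h1
    · have h3 : ∀ z, (σ.SameCycle x z ∨ σ.SameCycle y z) → (swap x y * σ).SameCycle x z := by
        rintro z (hz | hz)
        · exact up hz
        · exact hxy.trans (up hz)
      exact (h3 u h1).symm.trans (h3 v h2)

theorem orbit_swap_mul_of_mem (h : ¬ σ.SameCycle x y) (hu : u ∈ orbit σ x ∪ orbit σ y) :
    orbit (swap x y * σ) u = orbit σ x ∪ orbit σ y := by
  simp only [mem_union, mem_orbit] at hu
  ext z
  simp only [mem_union, mem_orbit, sameCycle_swap_mul_iff h, hu, true_and]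
  constructor
  · rintro (h1 | h1)
    · exact hu.imp (fun h => h.trans h1) (fun h => h.trans h1)
    · exact h1
  · exact Or.inr

theorem orbit_swap_mul_of_notMem (h : ¬ σ.SameCycle x y) (hu : u ∉ orbit σ x ∪ orbit σ y) :
    orbit (swap x y * σ) u = orbit σ u := by
  simp only [mem_union, mem_orbit] at hu
  ext z
  simp only [mem_orbit, sameCycle_swap_mul_iff h, hu, false_and, or_false]

theorem disjoint_orbit (h : ¬ σ.SameCycle x y) : Disjoint (orbit σ x) (orbit σ y) := by
  rw [Finset.disjoint_left]
  intro z hx hy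
  rw [mem_orbit] at hx hy
  exact h (hx.trans hy.symm)

theorem orbit_mem_cycles (σ : Perm α) (x : α) : orbit σ x ∈ cycles σ :=
  mem_image_of_mem _ (mem_univ x)

/-- The cycles of `σ` other than those of `x` and `y`. -/
def otherCycles (σ : Perm α) (x y : α) : Finset (Finset α) :=
  ((cycles σ).erase (orbit σ x)).erase (orbit σ y)

theorem cycles_eq_insert (h : ¬ σ.SameCycle x y) :
    cycles σ = insert (orbit σ x) (insert (orbit σ y) (otherCycles σ x y)) := by
  have hne : orbit σ y ≠ orbit σ x := fun e => h (orbit_eq_iff.mp e.symm)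
  rw [otherCycles, insert_erase, insert_erase (orbit_mem_cycles σ x)]
  exact mem_erase.mpr ⟨hne, orbit_mem_cycles σ y⟩

theorem orbit_notMem_left (h : ¬ σ.SameCycle x y) :
    orbit σ x ∉ insert (orbit σ y) (otherCycles σ x y) := by
  have hne : orbit σ x ≠ orbit σ y := fun e => h (orbit_eq_iff.mp e)
  simp [otherCycles, hne]

theorem orbit_notMem_right (σ : Perm α) (x y : α) : orbit σ y ∉ otherCycles σ x y := by
  simp [otherCycles]

theorem mem_otherCycles {s : Finset α} : s ∈ otherCycles σ x y ↔
    ∃ u, u ∉ orbit σ x ∪ orbit σ y ∧ orbit σ u = s := by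
  simp only [otherCycles, mem_erase, cycles, mem_image, mem_univ, true_and, mem_union, mem_orbit]
  constructor
  · rintro ⟨h1, h2, u, rfl⟩
    refine ⟨u, ?_, rfl⟩
    rintro (h3 | h3)
    · exact h2 (orbit_eq_iff.mpr h3.symm)
    · exact h1 (orbit_eq_iff.mpr h3.symm)
  · rintro ⟨u, h1, rfl⟩
    rw [not_or] at h1
    exact ⟨fun e => h1.2 (orbit_eq_iff.mp e).symm, fun e => h1.1 (orbit_eq_iff.mp e).symm, u, rfl⟩

theorem cycles_swap_mul (h : ¬ σ.SameCycle x y) :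
    cycles (swap x y * σ) = insert (orbit σ x ∪ orbit σ y) (otherCycles σ x y) := by
  ext s
  rw [mem_insert, mem_otherCycles]
  simp only [cycles, mem_image, mem_univ, true_and]
  constructor
  · rintro ⟨u, rfl⟩
    by_cases hu : u ∈ orbit σ x ∪ orbit σ y
    · exact Or.inl (orbit_swap_mul_of_mem h hu)
    · exact Or.inr ⟨u, hu, (orbit_swap_mul_of_notMem h hu).symm⟩
  · rintro (rfl | ⟨u, hu, rfl⟩)
    · exact ⟨x, orbit_swap_mul_of_mem h (mem_union_left _ (self_mem_orbit σ x))⟩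
    · exact ⟨u, orbit_swap_mul_of_notMem h hu⟩

theorem union_notMem_otherCycles (σ : Perm α) (x y : α) :
    orbit σ x ∪ orbit σ y ∉ otherCycles σ x y := by
  rw [mem_otherCycles]
  rintro ⟨u, hu, e⟩
  exact hu (e ▸ self_mem_orbit σ u)

theorem card_cycles_swap_mul (h : ¬ σ.SameCycle x y) :
    #(cycles (swap x y * σ)) + 1 = #(cycles σ) := by
  rw [cycles_swap_mul h, card_insert_of_notMem (union_notMem_otherCycles σ x y),
    cycles_eq_insert h, card_insert_of_notMem (orbit_notMem_left h),
    card_insert_of_notMem (orbit_notMem_right σ x y)]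

theorem card_cycles_le_swap_mul (h : σ.SameCycle x y) :
    #(cycles σ) ≤ #(cycles (swap x y * σ)) := by
  have e : swap x y * (swap x y * σ) = σ := by rw [← mul_assoc, swap_mul_self, one_mul]
  by_cases h' : (swap x y * σ).SameCycle x y
  · -- neither permutation separates `x` from `y`, so both have the same cycles
    have : ∀ u v, (swap x y * σ).SameCycle u v ↔ σ.SameCycle u v := by
      intro u v
      refine ⟨fun k => ?_, sameCycle_swap_mul_of_sameCycle h'⟩
      have := sameCycle_swap_mul_of_sameCycle (σ := swap x y * σ) (x := x) (y := y)
        (by rwa [e]) k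
      rwa [e] at this
    have h2 : orbit (swap x y * σ) = orbit σ := by
      funext u
      ext v
      simp [this]
    rw [cycles, cycles, h2]
  · have := card_cycles_swap_mul h'
    rw [e] at this
    omega

/-- The number of cycles, as the sum over all points of the inverse length of its cycle. -/
theorem sum_inv_card_orbit (σ : Perm α) :
    ∑ x, ((#(orbit σ x) : ℚ))⁻¹ = #(cycles σ) := by
  rw [← Finset.sum_fiberwise_of_maps_to (g := orbit σ) (t := cycles σ)
    (fun x _ => orbit_mem_cycles σ x), card_eq_sum_ones, Nat.cast_sum]
  refine Finset.sum_congr rfl fun s hs => ?_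
  obtain ⟨x, -, rfl⟩ := mem_image.mp hs
  have h1 : ({i | orbit σ i = orbit σ x} : Finset α) = orbit σ x := by
    ext z
    rw [mem_filter, orbit_eq_iff, mem_orbit]
    simp [Perm.sameCycle_comm]
  rw [h1, Finset.sum_congr rfl (g := fun _ => ((#(orbit σ x) : ℚ))⁻¹), Finset.sum_const,
    nsmul_eq_mul, mul_inv_cancel₀, Nat.cast_one]
  · exact_mod_cast (card_orbit_pos σ x).ne'
  · intro z hz
    rw [mem_orbit] at hz
    rw [orbit_eq_iff.mpr hz]

theorem card_cycles_one : #(cycles (1 : Perm α)) = Fintype.card α := by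
  have h := sum_inv_card_orbit (1 : Perm α)
  simp only [card_orbit_eq_one (Perm.one_apply _)] at h
  simp only [Nat.cast_one, inv_one, sum_const, card_univ, nsmul_eq_mul, mul_one] at h
  exact_mod_cast h.symm

/-- The product of the lengths of all cycles. -/
def lenProd (σ : Perm α) : ℚ := ∏ s ∈ cycles σ, (#s : ℚ)

theorem lenProd_pos (σ : Perm α) : 0 < lenProd σ := by
  refine Finset.prod_pos fun s hs => ?_
  obtain ⟨x, -, rfl⟩ := mem_image.mp hs
  exact_mod_cast card_orbit_pos σ x

theorem lenProd_swap_mul (h : ¬ σ.SameCycle x y) :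
    lenProd (swap x y * σ) =
      lenProd σ * ((#(orbit σ x) : ℚ)⁻¹ + (#(orbit σ y) : ℚ)⁻¹) := by
  have hx : (#(orbit σ x) : ℚ) ≠ 0 := by exact_mod_cast (card_orbit_pos σ x).ne'
  have hy : (#(orbit σ y) : ℚ) ≠ 0 := by exact_mod_cast (card_orbit_pos σ y).ne'
  rw [lenProd, lenProd, cycles_swap_mul h, prod_insert (union_notMem_otherCycles σ x y),
    cycles_eq_insert h, prod_insert (orbit_notMem_left h),
    prod_insert (orbit_notMem_right σ x y), card_union_of_disjoint (disjoint_orbit h)]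
  push_cast
  field_simp
  ring

end Orbits

/-! ### The norm in terms of cycles -/

section Norm

variable {n : ℕ}

theorem card_cycles_le (σ : Perm (Fin n)) : #(cycles σ) ≤ n := by
  have := card_image_le (s := (univ : Finset (Fin n))) (f := orbit σ)
  simpa [cycles] using this

theorem N_add_card_cycles (σ : Perm (Fin n)) : N σ + #(cycles σ) = n := by
  apply le_antisymm
  · induction hm : n - #(cycles σ) using Nat.strong_induction_on generalizing σ with
    | _ m ih =>
    by_cases h1 : σ = 1
    · rw [h1, N_one, card_cycles_one, Fintype.card_fin, zero_add]
    · obtain ⟨x, hx⟩ : ∃ x, σ x ≠ x := by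
        by_contra! hc
        exact h1 (Equiv.ext hc)
      -- the point `x` is fixed by `swap x (σ x) * σ`, so this permutation has one more cycle
      have h2 := card_cycles_swap_mul (σ := swap x (σ x) * σ) (x := x) (y := σ x) 
        (not_sameCycle_of_apply_eq_self (by simp) (Ne.symm hx))
      have e : swap x (σ x) * (swap x (σ x) * σ) = σ := by
        rw [← mul_assoc, swap_mul_self, one_mul]
      rw [e] at h2
      have h3 := card_cycles_le (swap x (σ x) * σ)
      have h4 := ih _ (by omega) (swap x (σ x) * σ) rfl
      have h5 := N_mul_le (swap x (σ x)) (swap x (σ x) * σ)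
      rw [e] at h5
      have h6 := N_le (σ := swap x (σ x)) [swap x (σ x)]
        (by simpa using ⟨x, σ x, Ne.symm hx, rfl⟩) (by simp)
      simp only [List.length_cons, List.length_nil] at h6
      omega
  · obtain ⟨l, h1, h2, h3⟩ := exists_factors σ
    rw [← h3, ← h2]
    clear h2 h3
    induction l with
    | nil => simp [card_cycles_one]
    | cons t l ih =>
      obtain ⟨x, y, hxy, rfl⟩ := h1 t (by simp)
      have h4 := ih fun t ht => h1 t (by simp [ht])
      rw [List.prod_cons, List.length_cons]
      by_cases h : l.prod.SameCycle x y
      · have := card_cycles_le_swap_mul h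
        omega
      · have := card_cycles_swap_mul h
        omega

theorem N_swap_mul {σ : Perm (Fin n)} {x y : Fin n} (h : ¬ σ.SameCycle x y) :
    N (swap x y * σ) = N σ + 1 := by
  have h1 := card_cycles_swap_mul h
  have h2 := N_add_card_cycles σ
  have h3 := N_add_card_cycles (swap x y * σ)
  omega

theorem N_swap_mul_le {σ : Perm (Fin n)} {x y : Fin n} (h : σ.SameCycle x y) :
    N (swap x y * σ) ≤ N σ := by
  have h1 := card_cycles_le_swap_mul h
  have h2 := N_add_card_cycles σ
  have h3 := N_add_card_cycles (swap x y * σ)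
  omega

theorem N_swap {x y : Fin n} (h : x ≠ y) : N (swap x y) = 1 := by
  have := N_swap_mul (σ := (1 : Perm (Fin n))) (x := x) (y := y)
    (fun hs => h (Perm.sameCycle_one.mp hs))
  rwa [mul_one, N_one] at this

/-- The norm as a sum of local contributions of the points. -/
theorem N_eq_sum (σ : Perm (Fin n)) : (N σ : ℚ) = ∑ x, (1 - (#(orbit σ x) : ℚ)⁻¹) := by
  rw [Finset.sum_sub_distrib, sum_inv_card_orbit]
  have : (N σ : ℚ) + #(cycles σ) = n := by exact_mod_cast N_add_card_cycles σ
  simp only [sum_const, card_univ, Fintype.card_fin, nsmul_eq_mul, mul_one]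
  linarith

theorem N_eq_zero {σ : Perm (Fin n)} : N σ = 0 ↔ σ = 1 := by
  constructor
  · intro h
    obtain ⟨l, -, h2, h3⟩ := exists_factors σ
    rw [h, List.length_eq_zero_iff] at h3
    rw [← h2, h3, List.prod_nil]
  · rintro rfl
    exact N_one

theorem card_support_le (σ : Perm (Fin n)) : #σ.support ≤ 2 * N σ := by
  have h : (#σ.support : ℚ) ≤ 2 * N σ := by
    rw [N_eq_sum, Finset.mul_sum, card_eq_sum_ones, Nat.cast_sum]
    refine le_trans ?_ (Finset.sum_le_sum_of_subset_of_nonneg (subset_univ σ.support) ?_)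
    · refine Finset.sum_le_sum fun x hx => ?_
      have : (2 : ℚ) ≤ #(orbit σ x) := by
        exact_mod_cast two_le_card_orbit (Perm.mem_support.mp hx)
      have := inv_anti₀ (by norm_num) this
      push_cast
      linarith
    · intro x _ _
      have : (1 : ℚ) ≤ #(orbit σ x) := by exact_mod_cast card_orbit_pos σ x
      have := inv_le_one_of_one_le₀ this
      linarith
  exact_mod_cast h

theorem orbit_mul_of_disjoint {σ τ : Perm (Fin n)} (h : σ.Disjoint τ) {x : Fin n}
    (hx : τ x = x) : orbit (σ * τ) x = orbit σ x := by
  ext z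
  simp only [mem_orbit, Perm.SameCycle, h.commute.mul_zpow, Perm.mul_apply,
    Perm.zpow_apply_eq_self_of_apply_eq_self hx]

theorem N_mul_of_disjoint {σ τ : Perm (Fin n)} (h : σ.Disjoint τ) : N (σ * τ) = N σ + N τ := by
  have : (N (σ * τ) : ℚ) = N σ + N τ := by
    rw [N_eq_sum, N_eq_sum, N_eq_sum, ← Finset.sum_add_distrib]
    refine Finset.sum_congr rfl fun x _ => ?_
    rcases h x with hx | hx
    · rw [h.commute.eq, orbit_mul_of_disjoint h.symm hx, card_orbit_eq_one hx]
      simp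
    · rw [orbit_mul_of_disjoint h hx, card_orbit_eq_one hx]
      simp
  exact_mod_cast this

theorem N_add_one_of_isCycle {σ : Perm (Fin n)} (h : σ.IsCycle) : N σ + 1 = #σ.support := by
  have hpos : (#σ.support : ℚ) ≠ 0 := by
    have := h.two_le_card_support
    exact_mod_cast (by omega : #σ.support ≠ 0)
  have h1 : ∀ x ∈ σ.support, orbit σ x = σ.support := by
    intro x hx
    ext z
    rw [mem_orbit]
    constructor
    · intro hz
      exact Perm.mem_support.mpr fun e =>
        Perm.mem_support.mp hx (hz.apply_eq_self_iff.mpr e)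
    · intro hz
      exact h.sameCycle (Perm.mem_support.mp hx) (Perm.mem_support.mp hz)
  have : (N σ : ℚ) + 1 = #σ.support := by
    rw [N_eq_sum, ← Finset.sum_subset (subset_univ σ.support),
      Finset.sum_congr rfl (g := fun _ => 1 - (#σ.support : ℚ)⁻¹), Finset.sum_const,
      nsmul_eq_mul]
    · field_simp
      ring
    · intro x hx
      rw [h1 x hx]
    · intro x _ hx
      rw [card_orbit_eq_one (Perm.notMem_support.mp hx)]
      simp
  exact_mod_cast this

/-- A nontrivial permutation has norm smaller than the number of points it moves. -/
theorem N_lt_card_support {σ : Perm (Fin n)} (h : σ ≠ 1) : N σ < #σ.support := by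
  induction σ using Perm.cycle_induction_on with
  | base_one => exact absurd rfl h
  | base_cycles σ hσ =>
    have := N_add_one_of_isCycle hσ
    omega
  | induction_disjoint σ τ hd hσ ih1 ih2 =>
    have h1 := ih1 hσ.ne_one
    have h2 : N τ ≤ #τ.support := by
      by_cases hτ : τ = 1
      · simp [hτ, N_one]
      · exact (ih2 hτ).le
    rw [N_mul_of_disjoint hd, hd.card_support_mul]
    omega

/-- A nontrivial permutation is a cycle, or a product of two nontrivial disjoint permutations the
first of which is a cycle. -/
theorem exists_cycle_mul {σ : Perm (Fin n)} (h : σ ≠ 1) :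
    σ.IsCycle ∨ ∃ τ ρ : Perm (Fin n), τ.IsCycle ∧ ρ ≠ 1 ∧ τ.Disjoint ρ ∧ σ = τ * ρ := by
  induction σ using Perm.cycle_induction_on with
  | base_one => exact absurd rfl h
  | base_cycles σ hσ => exact Or.inl hσ
  | induction_disjoint σ τ hd hσ ih1 ih2 =>
    by_cases hτ : τ = 1
    · left
      rwa [hτ, mul_one]
    · exact Or.inr ⟨σ, τ, hσ, hτ, hd, rfl⟩

theorem isCycle_of_card_support_le {σ : Perm (Fin n)} (h1 : σ ≠ 1) (h : #σ.support ≤ N σ + 1) :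
    σ.IsCycle := by
  rcases exists_cycle_mul h1 with hc | ⟨τ, ρ, hτ, hρ, hd, rfl⟩
  · exact hc
  · have h2 := N_lt_card_support hτ.ne_one
    have h3 := N_lt_card_support hρ
    rw [N_mul_of_disjoint hd, hd.card_support_mul] at h
    omega

theorem N_of_cycleType {σ : Perm (Fin n)} {k : ℕ}
    (h : σ.cycleType = Multiset.replicate k 2) : N σ = k := by
  have hs : #σ.support = 2 * k := by
    rw [← Perm.sum_cycleType, h]
    simp [mul_comm]
  have h2 : ∀ x ∈ σ.support, #(orbit σ x) = 2 := by
    intro x hx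
    have h1 : orbit σ x = (σ.cycleOf x).support := by
      ext z
      rw [mem_orbit, Perm.mem_support_cycleOf_iff' (Perm.mem_support.mp hx)]
    have h3 : #(σ.cycleOf x).support ∈ σ.cycleType := by
      rw [Perm.cycleType_def]
      exact Multiset.mem_map.mpr ⟨σ.cycleOf x, Perm.cycleOf_mem_cycleFactorsFinset_iff.mpr hx, rfl⟩
    rw [h] at h3
    rw [h1]
    exact Multiset.eq_of_mem_replicate h3
  have : (N σ : ℚ) = k := by
    rw [N_eq_sum, ← Finset.sum_subset (subset_univ σ.support),
      Finset.sum_congr rfl (g := fun _ => 1 - (2 : ℚ)⁻¹), Finset.sum_const, hs,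
      nsmul_eq_mul]
    · push_cast
      ring
    · intro x hx
      rw [h2 x hx]
      norm_num
    · intro x _ hx
      rw [card_orbit_eq_one (Perm.notMem_support.mp hx)]
      simp
  exact_mod_cast this

end Norm

/-! ### The weight of a permutation -/

section Weight

open scoped Nat

variable {n : ℕ}

/-- The fixed points of `σ`. -/
def fixedPts (σ : Perm (Fin n)) : Finset (Fin n) := {z | σ z = z}

@[simp] theorem mem_fixedPts {σ : Perm (Fin n)} {z : Fin n} : z ∈ fixedPts σ ↔ σ z = z := by
  simp [fixedPts]

theorem card_fixedPts_add (σ : Perm (Fin n)) : #(fixedPts σ) + #σ.support = n := by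
  have := Finset.card_filter_add_card_filter_not (s := (univ : Finset (Fin n)))
    (fun z => σ z = z)
  rw [card_univ, Fintype.card_fin] at this
  exact this

theorem card_fixedPts_erase_pos {σ : Perm (Fin n)} (x : Fin n) (h : 2 * (N σ + 1) ≤ n) :
    0 < #((fixedPts σ).erase x) := by
  have h1 := card_fixedPts_add σ
  have h2 := card_support_le σ
  have h3 := pred_card_le_card_erase (s := fixedPts σ) (a := x)
  omega

/-- The weight of `σ` that results when `f` of its fixed points are counted as such. The number of
cycles is `n - N σ`, so up to a global sign the sign is `-1` to the number of remaining cycles. -/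
def weightAux (σ : Perm (Fin n)) (f : ℕ) : ℚ :=
  lenProd σ * ((-1) ^ (N σ + f) * ((n - f - 1)! * f !))

/-- The weight of a permutation. Summing it over the coefficients of an element of `Gr n` yields
the functional `weightSum`, which detects indecomposable elements. -/
def weight (σ : Perm (Fin n)) : ℚ := weightAux σ #(fixedPts σ)

/-- The weight of `σ` relative to a marked point `x`: if `x` is fixed, it is not counted as a fixed
point. -/
def markedWeight (σ : Perm (Fin n)) (x : Fin n) : ℚ := weightAux σ #((fixedPts σ).erase x)

theorem fixedPts_swap_mul {σ : Perm (Fin n)} {x y : Fin n} (h : ¬ σ.SameCycle y x) :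
    fixedPts (swap y x * σ) = ((fixedPts σ).erase x).erase y := by
  ext z
  simp only [mem_fixedPts, mem_erase, Perm.mul_apply]
  constructor
  · intro hz
    rcases eq_or_ne (σ z) y with h1 | h1
    · rw [h1, swap_apply_left] at hz
      exact absurd ⟨-1, by simp [← h1, hz]⟩ h
    rcases eq_or_ne (σ z) x with h2 | h2
    · rw [h2, swap_apply_right] at hz
      exact absurd ⟨1, by simp [hz, h2]⟩ h
    rw [swap_apply_of_ne_of_ne h1 h2] at hz
    rw [hz] at h1 h2
    exact ⟨h1, h2, hz⟩
  · rintro ⟨h1, h2, h3⟩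
    rw [h3, swap_apply_of_ne_of_ne h1 h2]

theorem markedWeight_swap_mul {σ : Perm (Fin n)} {x y : Fin n} (h : ¬ σ.SameCycle y x) :
    markedWeight (swap y x * σ) y = weight (swap y x * σ) := by
  rw [markedWeight, weight, fixedPts_swap_mul h, erase_eq_of_notMem (notMem_erase _ _)]

theorem sum_orbit_inv (σ : Perm (Fin n)) (x : Fin n) :
    ∑ y ∈ orbit σ x, (#(orbit σ y) : ℚ)⁻¹ = 1 := by
  rw [Finset.sum_congr rfl (g := fun _ => (#(orbit σ x) : ℚ)⁻¹), Finset.sum_const,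
    nsmul_eq_mul, mul_inv_cancel₀]
  · exact_mod_cast (card_orbit_pos σ x).ne'
  · intro y hy
    rw [mem_orbit] at hy
    rw [orbit_eq_iff.mpr hy]

/-- Joining the cycle of the marked point `x` to each of the other cycles in all possible ways
multiplies the weight by a factor that depends only on the norm. A fixed point other than `x` is
needed: without one, the terms that join `x` to a fixed point, which would contribute
`f * (f - 1)! = f!`, are missing. -/
theorem sum_weight_swap_mul (σ : Perm (Fin n)) (x : Fin n)
    (hf : 0 < #((fixedPts σ).erase x)) :
    ∑ y with ¬ σ.SameCycle y x, weight (swap y x * σ) = (N σ + 2) * markedWeight σ x := by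
  obtain ⟨f, hf'⟩ : ∃ f, #((fixedPts σ).erase x) = f + 1 := ⟨_, (Nat.sub_add_cancel hf).symm⟩
  obtain ⟨m, hm⟩ : ∃ m, n = f + 1 + m + 1 := by
    have h1 : (fixedPts σ).erase x ⊆ univ.erase x := erase_subset_erase _ (subset_univ _)
    have h2 := card_le_card h1
    rw [card_erase_of_mem (mem_univ x), card_univ, Fintype.card_fin] at h2
    have := x.pos
    exact ⟨n - f - 2, by omega⟩
  have hmul : ∀ y, ¬ σ.SameCycle y x → weight (swap y x * σ) = lenProd σ *
      ((#(orbit σ y) : ℚ)⁻¹ + (#(orbit σ x) : ℚ)⁻¹) * ((-1) ^ (N σ + f) *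
        if σ y = y then - ((m + 1)! * f ! : ℚ) else (m ! * (f + 1)! : ℚ)) := by
    intro y hy
    have hne : y ≠ x := fun e => hy (e ▸ Perm.SameCycle.refl _ _)
    rw [weight, weightAux, lenProd_swap_mul hy, N_swap_mul hy, fixedPts_swap_mul hy]
    split_ifs with h
    · rw [card_erase_of_mem (mem_erase.mpr ⟨hne, mem_fixedPts.mpr h⟩), hf',
        show n - (f + 1 - 1) - 1 = m + 1 by omega, show f + 1 - 1 = f by omega]
      ring
    · rw [erase_eq_of_notMem (fun hc => h (mem_fixedPts.mp (mem_erase.mp hc).2)), hf',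
        show n - (f + 1) - 1 = m by omega]
      ring
  rw [Finset.sum_congr rfl fun y hy => hmul y (mem_filter.mp hy).2,
    ← Finset.sum_filter_add_sum_filter_not _ (fun y => σ y = y)]
  have hfix : ({y ∈ ({y | ¬ σ.SameCycle y x} : Finset (Fin n)) | σ y = y}) =
      (fixedPts σ).erase x := by
    ext z
    simp only [mem_filter, mem_univ, true_and, mem_erase, mem_fixedPts]
    refine and_congr_left fun hz => ⟨?_, fun hne => not_sameCycle_of_apply_eq_self hz hne⟩
    rintro h rfl
    exact h (Perm.SameCycle.refl _ _)
  -- splitting a sum over all points into the cycle of `x`, the other fixed points and the rest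
  have hsplit : ∀ g : Fin n → ℚ, ∑ y, g y = ∑ y ∈ orbit σ x, g y +
      (∑ y ∈ (fixedPts σ).erase x, g y +
        ∑ y ∈ ({y ∈ ({y | ¬ σ.SameCycle y x} : Finset (Fin n)) | ¬ σ y = y}), g y) := by
    intro g
    rw [← hfix, Finset.sum_filter_add_sum_filter_not, ← Finset.sum_filter_add_sum_filter_not univ
      (fun y => σ.SameCycle y x)]
    congr 2
    ext z
    simp [Perm.sameCycle_comm]
  have hA : ∑ y ∈ (fixedPts σ).erase x, (#(orbit σ y) : ℚ)⁻¹ = f + 1 := by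
    rw [Finset.sum_congr rfl (g := fun _ => (1 : ℚ)), Finset.sum_const, hf']
    · simp
    · intro y hy
      rw [card_orbit_eq_one (mem_fixedPts.mp (mem_erase.mp hy).2)]
      simp
  have h1 := hsplit fun y => (#(orbit σ y) : ℚ)⁻¹
  rw [sum_orbit_inv, hA, sum_inv_card_orbit] at h1
  have h2 := hsplit fun _ => 1
  simp only [Finset.sum_const, hf', card_univ, Fintype.card_fin, nsmul_eq_mul, mul_one] at h2
  have h3 : (N σ : ℚ) + #(cycles σ) = n := by exact_mod_cast N_add_card_cycles σ
  have hn : (n : ℚ) = f + 1 + m + 1 := by exact_mod_cast hm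
  have ha : (#(orbit σ x) : ℚ) ≠ 0 := by exact_mod_cast (card_orbit_pos σ x).ne'
  rw [hfix, Finset.sum_congr rfl (g := fun y => lenProd σ * ((-1) ^ (N σ + f) *
      (- ((m + 1)! * f ! : ℚ))) * ((#(orbit σ y) : ℚ)⁻¹ + (#(orbit σ x) : ℚ)⁻¹))
      (fun y hy => by rw [if_pos (mem_fixedPts.mp (mem_erase.mp hy).2)]; ring),
    Finset.sum_congr rfl (s₁ := filter (fun y => ¬ σ y = y) _)
      (g := fun y => lenProd σ * ((-1) ^ (N σ + f) *
      (m ! * (f + 1)! : ℚ)) * ((#(orbit σ y) : ℚ)⁻¹ + (#(orbit σ x) : ℚ)⁻¹))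
      (fun y hy => by rw [if_neg (mem_filter.mp hy).2]; ring), ← Finset.mul_sum,
      ← Finset.mul_sum, Finset.sum_add_distrib, Finset.sum_add_distrib, hA, Finset.sum_const,
      Finset.sum_const, hf', markedWeight, weightAux, hf', show n - (f + 1) - 1 = m by omega]
  set S := ∑ y ∈ ({y ∈ ({y | ¬ σ.SameCycle y x} : Finset (Fin n)) | ¬ σ y = y}),
    (#(orbit σ y) : ℚ)⁻¹
  set G := #({y ∈ ({y | ¬ σ.SameCycle y x} : Finset (Fin n)) | ¬ σ y = y})
  have hS : S = n - N σ - 1 - (f + 1) := by linarith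
  have hG : (G : ℚ) = n - #(orbit σ x) - (f + 1) := by
    push_cast at h2
    linarith
  rw [nsmul_eq_mul, nsmul_eq_mul, hS, hG, hn, Nat.factorial_succ, Nat.factorial_succ]
  push_cast
  field_simp
  ring

/-- Summing over the marked point gives zero. -/
theorem sum_markedWeight {σ : Perm (Fin n)} (h1 : σ ≠ 1) (hf : 0 < #(fixedPts σ)) :
    ∑ x, markedWeight σ x = 0 := by
  obtain ⟨f, hf'⟩ : ∃ f, #(fixedPts σ) = f + 1 := ⟨_, (Nat.sub_add_cancel hf).symm⟩
  have hs := card_fixedPts_add σ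
  have hpos : 0 < #σ.support := by
    rw [card_pos, Finset.nonempty_iff_ne_empty, Ne, Perm.support_eq_empty_iff]
    exact h1
  obtain ⟨m, hm⟩ : ∃ m, #σ.support = m + 1 := ⟨_, (Nat.sub_add_cancel hpos).symm⟩
  have hx : ∀ x, markedWeight σ x = if σ x = x then weightAux σ f else weightAux σ (f + 1) := by
    intro x
    rw [markedWeight]
    split_ifs with h
    · rw [card_erase_of_mem (mem_fixedPts.mpr h), hf', show f + 1 - 1 = f by omega]
    · rw [erase_eq_of_notMem (fun hc => h (mem_fixedPts.mp hc)), hf']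
  rw [Finset.sum_congr rfl fun x _ => hx x, Finset.sum_ite, Finset.sum_const, Finset.sum_const]
  change #(fixedPts σ) • _ + #σ.support • _ = (0 : ℚ)
  rw [hf', hm, weightAux, weightAux, show n - f - 1 = m + 1 by omega,
    show n - (f + 1) - 1 = m by omega, nsmul_eq_mul, nsmul_eq_mul, Nat.factorial_succ,
    Nat.factorial_succ]
  push_cast
  ring

end Weight

/-! ### Sums over walks -/

section Walks

variable {n : ℕ}

namespace Gr

theorem eq_sum_of (a : Gr n) : a = ∑ σ, a.coeff σ • of σ := by
  ext ρ
  simp [coeff_sum, coeff_of]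

theorem coeff_mul_of (a : Gr n) (τ ρ : Perm (Fin n)) :
    (a * of τ).coeff ρ = if N (ρ * τ⁻¹) + N τ = N ρ then a.coeff (ρ * τ⁻¹) else 0 := by
  have e : (ρ * τ⁻¹)⁻¹ * ρ = τ := by group
  rw [coeff_mul, Finset.sum_eq_single (ρ * τ⁻¹)]
  · rw [e, coeff_of, if_pos rfl, mul_one]
  · intro σ _ hσ
    have : σ⁻¹ * ρ ≠ τ := fun h => hσ (by rw [← h]; group)
    simp [coeff_of, this]
  · simp

theorem of_swap_mul_of {x y : Fin n} (hxy : y ≠ x) (σ : Perm (Fin n)) :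
    of (swap y x) * of σ = if σ.SameCycle y x then 0 else of (swap y x * σ) := by
  rw [of_mul_of, N_swap hxy]
  by_cases h : σ.SameCycle y x
  · have := N_swap_mul_le h
    rw [if_pos h, if_neg (by omega)]
  · rw [if_neg h, if_pos (by rw [N_swap_mul h, add_comm])]

/-- Conjugation by `g`. -/
def conj (g : Perm (Fin n)) : Gr n →ₗ[ℚ] Gr n where
  toFun a := fun σ => a.coeff (g⁻¹ * σ * g)
  map_add' _ _ := rfl
  map_smul' _ _ := rfl

theorem coeff_conj (g : Perm (Fin n)) (a : Gr n) (σ : Perm (Fin n)) :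
    (conj g a).coeff σ = a.coeff (g⁻¹ * σ * g) := rfl

theorem conj_of (g σ : Perm (Fin n)) : conj g (of σ) = of (g * σ * g⁻¹) := by
  ext ρ
  rw [coeff_conj, coeff_of, coeff_of]
  refine if_congr ⟨?_, ?_⟩ rfl rfl
  · rintro rfl
    group
  · rintro rfl
    group

theorem conj_mul (g : Perm (Fin n)) (a b : Gr n) : conj g (a * b) = conj g a * conj g b := by
  ext ρ
  rw [coeff_conj, coeff_mul, coeff_mul, ← Equiv.sum_comp (MulAut.conj g⁻¹).toEquiv]
  refine Finset.sum_congr rfl fun σ _ => ?_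
  have e : (g⁻¹ * σ * g⁻¹⁻¹)⁻¹ * (g⁻¹ * ρ * g) = g⁻¹ * (σ⁻¹ * ρ) * g⁻¹⁻¹ := by group
  have e' : g⁻¹ * ρ * g = g⁻¹ * ρ * g⁻¹⁻¹ := by group
  change (if N (g⁻¹ * σ * g⁻¹⁻¹) + N ((g⁻¹ * σ * g⁻¹⁻¹)⁻¹ * (g⁻¹ * ρ * g)) = N (g⁻¹ * ρ * g) then
    a.coeff (g⁻¹ * σ * g⁻¹⁻¹) * b.coeff ((g⁻¹ * σ * g⁻¹⁻¹)⁻¹ * (g⁻¹ * ρ * g)) else 0) = _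
  rw [e, e', N_conj, N_conj, N_conj, inv_inv, coeff_conj, coeff_conj]

theorem mem_A_iff {a : Gr n} : a ∈ A n ↔ ∀ g, conj g a = a := by
  constructor
  · intro h g
    ext σ
    rw [coeff_conj]
    have := h g (g⁻¹ * σ * g)
    rw [← this]
    congr 1
    group
  · intro h g σ
    rw [← h g, coeff_conj, h g]
    congr 1
    group

end Gr

open Gr

/-- The linear functional on `Gr n` whose value at `[σ]` is the weight of `σ`. -/
def weightSum : Gr n →ₗ[ℚ] ℚ where
  toFun a := ∑ σ, a.coeff σ * weight σ
  map_add' a b := by simp [add_mul, Finset.sum_add_distrib]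
  map_smul' c a := by simp [mul_assoc, Finset.mul_sum]

theorem weightSum_apply (a : Gr n) : weightSum a = ∑ σ, a.coeff σ * weight σ := rfl

theorem weightSum_of (σ : Perm (Fin n)) : weightSum (of σ) = weight σ := by
  simp [weightSum_apply, coeff_of]

/-- The sum of the products `[swap xⱼ xⱼ₋₁] * ⋯ * [swap x₁ x]` over all walks `x, x₁, …, xⱼ` in the
complete graph that start at `x`. Only the walks without repetition contribute, and those
contribute cycles of length `j + 1` through `x`. -/
def walkSum : ℕ → Fin n → Gr n
  | 0, _ => 1
  | j + 1, x => ∑ y ∈ univ.erase x, walkSum j y * of (swap y x)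

/-- The sum of `walkSum j x` over all starting points; a positive multiple of the sum of all cycles
of length `j + 1`. -/
def cycleSum (n j : ℕ) : Gr n := ∑ x, walkSum j x

theorem weightSum_walkSum_succ_mul (j : ℕ) (x : Fin n) (σ : Perm (Fin n)) :
    weightSum (walkSum (j + 1) x * of σ) =
      ∑ y with ¬ σ.SameCycle y x, weightSum (walkSum j y * of (swap y x * σ)) := by
  rw [walkSum, Finset.sum_mul, map_sum, Finset.sum_filter,
    ← Finset.sum_erase (s := univ) (a := x)]
  · refine Finset.sum_congr rfl fun y hy => ?_
    rw [mul_assoc, of_swap_mul_of (mem_erase.mp hy).1]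
    split_ifs <;> simp
  · rw [if_neg (not_not.mpr (Perm.SameCycle.refl _ _))]

theorem weightSum_walkSum_mul (j : ℕ) (x : Fin n) (σ : Perm (Fin n))
    (h : 2 * (N σ + (j + 1)) ≤ n) :
    weightSum (walkSum (j + 1) x * of σ) =
      (∏ t ∈ range (j + 1), (N σ + t + 2 : ℚ)) * markedWeight σ x := by
  induction j generalizing x σ with
  | zero =>
    have hpos := card_fixedPts_erase_pos (σ := σ) x (by omega)
    rw [weightSum_walkSum_succ_mul]
    simp [walkSum, weightSum_of, sum_weight_swap_mul σ x hpos]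
  | succ j ih =>
    have hpos := card_fixedPts_erase_pos (σ := σ) x (by omega)
    have h3 : ∀ y ∈ ({y | ¬ σ.SameCycle y x} : Finset (Fin n)),
        weightSum (walkSum (j + 1) y * of (swap y x * σ)) =
        (∏ t ∈ range (j + 1), (N σ + (t + 1 : ℕ) + 2 : ℚ)) * weight (swap y x * σ) := by
      intro y hy
      have hy' := (mem_filter.mp hy).2
      have hN := N_swap_mul hy'
      rw [ih _ _ (by omega), markedWeight_swap_mul hy', hN]
      congr 1
      refine Finset.prod_congr rfl fun t _ => ?_
      push_cast
      ring
    rw [weightSum_walkSum_succ_mul, Finset.sum_congr rfl h3, ← Finset.mul_sum,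
      sum_weight_swap_mul σ x hpos, Finset.prod_range_succ' _ (j + 1)]
    push_cast
    ring

theorem weightSum_cycleSum_mul_of {j : ℕ} {σ : Perm (Fin n)} (h1 : σ ≠ 1)
    (h : 2 * (N σ + (j + 1)) ≤ n) : weightSum (cycleSum n (j + 1) * of σ) = 0 := by
  have hpos : 0 < #(fixedPts σ) := by
    have h2 := card_fixedPts_add σ
    have h3 := card_support_le σ
    omega
  rw [cycleSum, Finset.sum_mul, map_sum,
    Finset.sum_congr rfl fun x _ => weightSum_walkSum_mul j x σ h, ← Finset.mul_sum,
    sum_markedWeight h1 hpos, mul_zero]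

theorem conj_walkSum (g : Perm (Fin n)) (j : ℕ) (x : Fin n) :
    conj g (walkSum j x) = walkSum j (g x) := by
  induction j generalizing x with
  | zero =>
    have : (1 : Gr n) = of 1 := rfl
    rw [walkSum, walkSum, this, conj_of, mul_one, mul_inv_cancel]
  | succ j ih =>
    rw [walkSum, walkSum, map_sum]
    refine Finset.sum_equiv g (fun y => by simp) fun y _ => ?_
    rw [conj_mul, ih, conj_of, swap_apply_apply]

theorem cycleSum_mem_A (n j : ℕ) : cycleSum n j ∈ A n := by
  rw [mem_A_iff]
  intro g
  rw [cycleSum, map_sum]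
  simp only [conj_walkSum]
  exact Equiv.sum_comp g (walkSum j)

theorem coeff_walkSum_nonneg (j : ℕ) (x : Fin n) (σ : Perm (Fin n)) :
    0 ≤ (walkSum j x).coeff σ := by
  induction j generalizing x σ with
  | zero =>
    rw [walkSum, coeff_one]
    split_ifs <;> norm_num
  | succ j ih =>
    rw [walkSum, coeff_sum]
    refine Finset.sum_nonneg fun y _ => ?_
    rw [coeff_mul_of]
    split_ifs
    · exact ih _ _
    · exact le_rfl

/-- A permutation that occurs in `walkSum j x` has norm `j` and moves only points of a set of size
`j + 1`. -/
theorem exists_of_coeff_walkSum_ne_zero {j : ℕ} {x : Fin n} {σ : Perm (Fin n)}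
    (h : (walkSum j x).coeff σ ≠ 0) :
    N σ = j ∧ ∃ s : Finset (Fin n), x ∈ s ∧ #s ≤ j + 1 ∧ σ.support ⊆ s := by
  induction j generalizing x σ with
  | zero =>
    rw [walkSum, coeff_one] at h
    have h1 : σ = 1 := by
      by_contra hc
      exact h (if_neg hc)
    subst h1
    exact ⟨N_one, {x}, by simp, by simp, by simp⟩
  | succ j ih =>
    rw [walkSum, coeff_sum] at h
    obtain ⟨y, hy, h1⟩ := Finset.exists_ne_zero_of_sum_ne_zero h
    have hyx := (mem_erase.mp hy).1
    rw [coeff_mul_of] at h1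
    have h2 : N (σ * (swap y x)⁻¹) + N (swap y x) = N σ := by
      by_contra hc
      exact h1 (if_neg hc)
    rw [if_pos h2] at h1
    obtain ⟨h3, s, hys, hs, h4⟩ := ih h1
    refine ⟨by rw [← h2, h3, N_swap hyx], insert x s, mem_insert_self _ _,
      (card_insert_le _ _).trans (by omega), ?_⟩
    intro z hz
    by_contra hc
    rw [mem_insert, not_or] at hc
    have h5 : z ∉ (σ * (swap y x)⁻¹).support := fun hm => hc.2 (h4 hm)
    have hzy : z ≠ y := fun e => hc.2 (e ▸ hys)
    rw [Perm.notMem_support, swap_inv, Perm.mul_apply, swap_apply_of_ne_of_ne hzy hc.1] at h5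
    exact Perm.mem_support.mp hz h5

theorem exists_coeff_walkSum_pos {j : ℕ} {x : Fin n} {s : Finset (Fin n)} (hx : x ∈ s)
    (hs : #s = j + 1) : ∃ σ : Perm (Fin n), σ.support ⊆ s ∧ 0 < (walkSum j x).coeff σ := by
  induction j generalizing x s with
  | zero => exact ⟨1, by simp, by rw [walkSum, coeff_one, if_pos rfl]; norm_num⟩
  | succ j ih =>
    have hs' : #(s.erase x) = j + 1 := by
      rw [card_erase_of_mem hx]
      omega
    obtain ⟨y, hy⟩ : (s.erase x).Nonempty := card_pos.mp (by omega)
    obtain ⟨σ, h1, h2⟩ := ih hy hs'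
    have hyx : y ≠ x := (mem_erase.mp hy).1
    have hσx : σ x = x := by
      rw [← Perm.notMem_support]
      exact fun h => notMem_erase x s (h1 h)
    have hsc : ¬ σ.SameCycle y x := fun h =>
      not_sameCycle_of_apply_eq_self hσx hyx.symm h.symm
    have hN : N (σ * swap y x) = N σ + N (swap y x) := by
      have := N_conj (swap y x) (σ * swap y x)
      rw [← mul_assoc, mul_inv_cancel_right, N_swap_mul hsc] at this
      rw [N_swap hyx, this]
    refine ⟨σ * swap y x, ?_, ?_⟩
    · intro z hz
      by_contra hc
      refine Perm.mem_support.mp hz ?_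
      have hzx : z ≠ x := fun e => hc (e ▸ hx)
      have hzy : z ≠ y := fun e => hc (e ▸ (mem_erase.mp hy).2)
      rw [Perm.mul_apply, swap_apply_of_ne_of_ne hzy hzx, ← Perm.notMem_support]
      exact fun h => hc (mem_erase.mp (h1 h)).2
    · rw [walkSum, coeff_sum]
      refine Finset.sum_pos' (fun z _ => ?_) ⟨y, mem_erase.mpr ⟨hyx, mem_univ _⟩, ?_⟩
      · rw [coeff_mul_of]
        split_ifs
        · exact coeff_walkSum_nonneg _ _ _
        · exact le_rfl
      · rw [coeff_mul_of, mul_inv_cancel_right, if_pos hN.symm]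
        exact h2

theorem of_coeff_cycleSum_ne_zero {j : ℕ} {σ : Perm (Fin n)}
    (h : (cycleSum n j).coeff σ ≠ 0) : N σ = j ∧ #σ.support ≤ j + 1 := by
  rw [cycleSum, coeff_sum] at h
  obtain ⟨x, -, h1⟩ := Finset.exists_ne_zero_of_sum_ne_zero h
  obtain ⟨h2, s, -, hs, h3⟩ := exists_of_coeff_walkSum_ne_zero h1
  exact ⟨h2, (card_le_card h3).trans hs⟩

theorem sum_coeff_cycleSum_pos {j : ℕ} (h : j + 1 ≤ n) :
    0 < ∑ σ, (cycleSum n j).coeff σ := by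
  obtain ⟨s, -, hs⟩ := exists_subset_card_eq (s := (univ : Finset (Fin n))) (n := j + 1)
    (by simpa using h)
  obtain ⟨x, hx⟩ : s.Nonempty := card_pos.mp (by omega)
  obtain ⟨σ, -, hσ⟩ := exists_coeff_walkSum_pos hx hs
  simp only [cycleSum, coeff_sum]
  refine Finset.sum_pos' (fun τ _ => Finset.sum_nonneg fun y _ => coeff_walkSum_nonneg _ _ _)
    ⟨σ, mem_univ _, ?_⟩
  exact Finset.sum_pos' (fun y _ => coeff_walkSum_nonneg _ _ _) ⟨x, mem_univ _, hσ⟩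

end Walks

/-! ### Homogeneous invariant elements -/

section Homogeneous

open Gr

variable {n : ℕ}

/-- The homogeneous part of norm `k` of the invariant subalgebra. -/
def homog (n k : ℕ) : Submodule ℚ (Gr n) where
  carrier := {a | a ∈ A n ∧ ∀ σ, a.coeff σ ≠ 0 → N σ = k}
  zero_mem' := ⟨zero_mem _, fun _ h => absurd rfl h⟩
  add_mem' {a b} ha hb := by
    refine ⟨add_mem ha.1 hb.1, fun σ h => ?_⟩
    by_cases h1 : a.coeff σ = 0
    · exact hb.2 σ fun h2 => h (by rw [coeff_add, h1, h2, add_zero])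
    · exact ha.2 σ h1
  smul_mem' c a ha := by
    refine ⟨Subalgebra.smul_mem _ ha.1 c, fun σ h => ha.2 σ fun h1 => h ?_⟩
    rw [coeff_smul, h1, mul_zero]

theorem cycleSum_mem_homog (n j : ℕ) : cycleSum n j ∈ homog n j :=
  ⟨cycleSum_mem_A n j, fun _ h => (of_coeff_cycleSum_ne_zero h).1⟩

/-- The sum of all conjugates of an element. -/
def conjSum (a : Gr n) : Gr n := ∑ g, conj g a

/-- The sum of all conjugates of `[σ]`; a positive multiple of the class sum of `σ`. -/
def classSum (σ : Perm (Fin n)) : Gr n := conjSum (of σ)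

theorem classSum_eq (σ : Perm (Fin n)) : classSum σ = ∑ g, of (g * σ * g⁻¹) := by
  simp only [classSum, conjSum, conj_of]

theorem conjSum_of_mem_A {a : Gr n} (ha : a ∈ A n) :
    conjSum a = (Fintype.card (Perm (Fin n)) : ℚ) • a := by
  rw [conjSum, Finset.sum_congr rfl fun g _ => mem_A_iff.mp ha g, Finset.sum_const, card_univ,
    Nat.cast_smul_eq_nsmul]

theorem conjSum_sum {ι : Type*} (s : Finset ι) (f : ι → Gr n) :
    conjSum (∑ i ∈ s, f i) = ∑ i ∈ s, conjSum (f i) := by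
  simp only [conjSum, map_sum]
  exact Finset.sum_comm

theorem conjSum_smul (c : ℚ) (a : Gr n) : conjSum (c • a) = c • conjSum a := by
  simp only [conjSum, map_smul, Finset.smul_sum]

theorem conjSum_eq_sum (a : Gr n) : conjSum a = ∑ σ, a.coeff σ • classSum σ := by
  conv_lhs => rw [eq_sum_of a]
  simp only [conjSum_sum, conjSum_smul, classSum]

theorem classSum_conj (h σ : Perm (Fin n)) : classSum (h * σ * h⁻¹) = classSum σ := by
  rw [classSum_eq, classSum_eq, ← Equiv.sum_comp (Equiv.mulRight h⁻¹)]
  refine Finset.sum_congr rfl fun g _ => ?_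
  congr 1
  simp only [coe_mulRight]
  group

theorem classSum_eq_of_cycleType {σ τ : Perm (Fin n)} (h : σ.cycleType = τ.cycleType) :
    classSum σ = classSum τ := by
  obtain ⟨g, hg⟩ := isConj_iff.mp (Perm.isConj_iff_cycleType_eq.mpr h)
  rw [← hg, classSum_conj]

theorem classSum_mem_homog (σ : Perm (Fin n)) : classSum σ ∈ homog n (N σ) := by
  constructor
  · rw [mem_A_iff]
    intro h
    rw [classSum_eq, map_sum]
    refine Fintype.sum_equiv (Equiv.mulLeft h) _ _ fun g => ?_
    rw [conj_of]
    congr 1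
  · intro ρ h
    rw [classSum_eq, coeff_sum] at h
    obtain ⟨g, -, h1⟩ := Finset.exists_ne_zero_of_sum_ne_zero h
    rw [coeff_of] at h1
    have h2 : ρ = g * σ * g⁻¹ := by
      by_contra hc
      exact h1 (if_neg hc)
    rw [h2, N_conj]

/-- An invariant element lies in a subspace that contains the class sums of all permutations
occurring in it. -/
theorem mem_of_classSum_mem {M : Submodule ℚ (Gr n)} {a : Gr n} (ha : a ∈ A n)
    (h : ∀ σ, a.coeff σ ≠ 0 → classSum σ ∈ M) : a ∈ M := by
  have h1 := conjSum_of_mem_A ha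
  have h2 : conjSum a ∈ M := by
    rw [conjSum_eq_sum]
    refine Submodule.sum_mem _ fun σ _ => ?_
    by_cases hσ : a.coeff σ = 0
    · rw [hσ, zero_smul]
      exact zero_mem _
    · exact M.smul_mem _ (h σ hσ)
  rw [h1] at h2
  exact (M.smul_mem_iff (by exact_mod_cast Fintype.card_ne_zero)).mp h2

/-- The class sum of a cycle is a multiple of the corresponding `cycleSum`. -/
theorem classSum_mem_of_isCycle {σ : Perm (Fin n)} (hσ : σ.IsCycle) {M : Submodule ℚ (Gr n)}
    (h : cycleSum n (N σ) ∈ M) : classSum σ ∈ M := by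
  have h1 := N_add_one_of_isCycle hσ
  have h2 := hσ.two_le_card_support
  have hn : N σ + 1 ≤ n := by
    rw [h1]
    exact (card_le_univ _).trans_eq (Fintype.card_fin n)
  have h3 : conjSum (cycleSum n (N σ)) = (∑ τ, (cycleSum n (N σ)).coeff τ) • classSum σ := by
    rw [conjSum_eq_sum, Finset.sum_smul]
    refine Finset.sum_congr rfl fun τ _ => ?_
    by_cases hτ : (cycleSum n (N σ)).coeff τ = 0
    · rw [hτ, zero_smul, zero_smul]
    · obtain ⟨h4, h5⟩ := of_coeff_cycleSum_ne_zero hτ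
      have hc : τ.IsCycle := by
        refine isCycle_of_card_support_le ?_ (by omega)
        rw [Ne, ← N_eq_zero]
        omega
      have h6 := N_add_one_of_isCycle hc
      rw [classSum_eq_of_cycleType]
      rw [hc.cycleType, hσ.cycleType, ← h6, ← h1, h4]
  rw [conjSum_of_mem_A (cycleSum_mem_A n _)] at h3
  refine (M.smul_mem_iff (sum_coeff_cycleSum_pos hn).ne').mp ?_
  rw [← h3]
  exact M.smul_mem _ h

/-- The span of the products of a `cycleSum` with a homogeneous invariant element, both of positive
norm, of total norm `k`. -/
def decomposables (n k : ℕ) : Submodule ℚ (Gr n) :=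
  Submodule.span ℚ {z | ∃ i j : ℕ, 0 < i ∧ 0 < j ∧ i + j = k ∧
    ∃ b ∈ homog n j, z = cycleSum n i * b}

/-- The product of two class sums, summed over all its conjugates. -/
theorem conjSum_classSum_mul (τ ρ : Perm (Fin n)) :
    conjSum (classSum τ * classSum ρ) = ∑ p : Perm (Fin n) × Perm (Fin n),
      if N (p.1 * τ * p.1⁻¹ * (p.2 * ρ * p.2⁻¹)) = N τ + N ρ then
        classSum (p.1 * τ * p.1⁻¹ * (p.2 * ρ * p.2⁻¹)) else 0 := by
  rw [classSum_eq, classSum_eq, Finset.sum_mul_sum, ← Finset.univ_product_univ,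
    Finset.sum_product, conjSum_sum]
  refine Finset.sum_congr rfl fun g _ => ?_
  rw [conjSum_sum]
  refine Finset.sum_congr rfl fun h _ => ?_
  rw [of_mul_of, N_conj, N_conj]
  split_ifs
  · rfl
  · simp [conjSum]

/-- The support of a product of a conjugate of `τ` and a conjugate of `ρ` is smaller than that of
`τ * ρ`, unless these conjugates are disjoint. -/
theorem card_support_lt_or_cycleType_eq {τ ρ : Perm (Fin n)} (hd : τ.Disjoint ρ)
    (g h : Perm (Fin n)) :
    #(g * τ * g⁻¹ * (h * ρ * h⁻¹)).support < #(τ * ρ).support ∨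
      (g * τ * g⁻¹ * (h * ρ * h⁻¹)).cycleType = (τ * ρ).cycleType := by
  by_cases hd' : (g * τ * g⁻¹).Disjoint (h * ρ * h⁻¹)
  · right
    rw [hd'.cycleType_mul, hd.cycleType_mul, Perm.cycleType_conj, Perm.cycleType_conj]
  · left
    rw [hd.card_support_mul]
    have h1 := card_union_add_card_inter (g * τ * g⁻¹).support (h * ρ * h⁻¹).support
    rw [Perm.card_support_conj, Perm.card_support_conj] at h1
    have h2 : 0 < #((g * τ * g⁻¹).support ∩ (h * ρ * h⁻¹).support) := by
      rw [card_pos, nonempty_iff_ne_empty, Ne, ← Finset.disjoint_iff_inter_eq_empty,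
        ← Perm.disjoint_iff_disjoint_support]
      exact hd'
    have h3 := card_le_card (Perm.support_mul_le (g * τ * g⁻¹) (h * ρ * h⁻¹))
    change _ ≤ #((g * τ * g⁻¹).support ∪ (h * ρ * h⁻¹).support) at h3
    omega

/-- Up to decomposable elements, every class sum of positive norm `k` is a multiple of
`cycleSum n k`: if `σ` is the disjoint product of a cycle `τ` and `ρ ≠ 1`, then
`classSum τ * classSum ρ` is a positive multiple of `classSum σ` plus class sums of permutations
with smaller support. -/
theorem classSum_mem_sup {σ : Perm (Fin n)} (h1 : σ ≠ 1) :
    classSum σ ∈ decomposables n (N σ) ⊔ Submodule.span ℚ {cycleSum n (N σ)} := by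
  induction hm : #σ.support using Nat.strong_induction_on generalizing σ with
  | _ m ih =>
  rcases exists_cycle_mul h1 with hc | ⟨τ, ρ, hτ, hρ, hd, hσ⟩
  · exact classSum_mem_of_isCycle hc
      (Submodule.mem_sup_right (Submodule.mem_span_singleton_self _))
  · have hN : N σ = N τ + N ρ := by rw [hσ, N_mul_of_disjoint hd]
    set M := decomposables n (N σ) ⊔ Submodule.span ℚ {cycleSum n (N σ)} with hM
    have hprod : classSum τ * classSum ρ ∈ M := by
      refine Submodule.mem_sup_left ?_
      refine classSum_mem_of_isCycle hτ
        (M := (decomposables n (N σ)).comap (LinearMap.mulRight ℚ (classSum ρ))) ?_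
      rw [Submodule.mem_comap, LinearMap.mulRight_apply]
      refine Submodule.subset_span ⟨N τ, N ρ, ?_, ?_, hN.symm, _, classSum_mem_homog ρ, rfl⟩
      · exact Nat.pos_of_ne_zero fun h => hτ.ne_one (N_eq_zero.mp h)
      · exact Nat.pos_of_ne_zero fun h => hρ (N_eq_zero.mp h)
    have hsum := conjSum_classSum_mul τ ρ
    rw [conjSum_of_mem_A (mul_mem (classSum_mem_homog τ).1 (classSum_mem_homog ρ).1)] at hsum
    set π : Perm (Fin n) × Perm (Fin n) → Perm (Fin n) := fun p =>
      p.1 * τ * p.1⁻¹ * (p.2 * ρ * p.2⁻¹) with hπ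
    -- the pairs of conjugates whose product is conjugate to `σ`
    set good : Finset (Perm (Fin n) × Perm (Fin n)) := {p | (π p).cycleType = σ.cycleType}
      with hgood
    have hgoodsum : ∑ p ∈ good, (if N (π p) = N τ + N ρ then classSum (π p) else 0) =
        (#good : ℚ) • classSum σ := by
      rw [Finset.sum_congr rfl (g := fun _ => classSum σ), Finset.sum_const,
        Nat.cast_smul_eq_nsmul]
      intro p hp
      have hp' : (π p).cycleType = σ.cycleType := (mem_filter.mp hp).2
      obtain ⟨g, hg⟩ := isConj_iff.mp (Perm.isConj_iff_cycleType_eq.mpr hp')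
      rw [classSum_eq_of_cycleType hp', if_pos]
      rw [← hN, ← hg, N_conj]
    have hbad : ∑ p ∈ univ \ good, (if N (π p) = N τ + N ρ then classSum (π p) else 0) ∈ M := by
      refine Submodule.sum_mem _ fun p hp => ?_
      split_ifs with hNp
      · have hp' : (π p).cycleType ≠ σ.cycleType := by
          intro h
          exact (mem_sdiff.mp hp).2 (mem_filter.mpr ⟨mem_univ _, h⟩)
        have hlt : #(π p).support < m := by
          rw [hσ] at hm hp'
          rcases card_support_lt_or_cycleType_eq hd p.1 p.2 with h | h
          · exact h.trans_eq hm
          · exact absurd h hp'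
        have hp1 : π p ≠ 1 := by
          rw [Ne, ← N_eq_zero, hNp, ← hN, N_eq_zero]
          exact h1
        have := ih _ hlt hp1 rfl
        rwa [hNp, ← hN] at this
      · exact zero_mem _
    have hcard : (#good : ℚ) ≠ 0 := by
      have : (1, 1) ∈ good := mem_filter.mpr ⟨mem_univ _, by simp [hπ, hσ]⟩
      exact_mod_cast (card_pos.mpr ⟨_, this⟩).ne'
    refine (M.smul_mem_iff hcard).mp ?_
    rw [← hgoodsum]
    rw [← Finset.sum_sdiff (subset_univ good)] at hsum
    have h2 := M.sub_mem (M.smul_mem (Fintype.card (Perm (Fin n)) : ℚ) hprod) hbad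
    rwa [hsum, add_sub_cancel_left] at h2

theorem homog_le_sup {k : ℕ} (hk : 0 < k) :
    homog n k ≤ decomposables n k ⊔ Submodule.span ℚ {cycleSum n k} := by
  intro a ha
  refine mem_of_classSum_mem ha.1 fun σ hσ => ?_
  have h1 := ha.2 σ hσ
  have h2 : σ ≠ 1 := by
    rw [Ne, ← N_eq_zero]
    omega
  exact h1 ▸ classSum_mem_sup h2

theorem weightSum_decomposables {k : ℕ} (hk : 2 * k ≤ n) {z : Gr n}
    (hz : z ∈ decomposables n k) : weightSum z = 0 := by
  refine (Submodule.span_le (p := LinearMap.ker weightSum)).mpr ?_ hz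
  rintro _ ⟨i, j, hi, hj, rfl, b, hb, rfl⟩
  obtain ⟨i, rfl⟩ : ∃ i', i = i' + 1 := ⟨i - 1, by omega⟩
  rw [SetLike.mem_coe, LinearMap.mem_ker, eq_sum_of b, Finset.mul_sum, map_sum]
  refine Finset.sum_eq_zero fun σ _ => ?_
  rw [mul_smul_comm, map_smul]
  by_cases hσ : b.coeff σ = 0
  · rw [hσ, zero_smul]
  · have h1 := hb.2 σ hσ
    rw [weightSum_cycleSum_mul_of _ (by omega), smul_zero]
    rw [Ne, ← N_eq_zero]
    omega

end Homogeneous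

/-! ### The elements `δ n i` as generators -/

section Generators

open Gr

variable {n : ℕ}

theorem coeff_delta (n i : ℕ) (σ : Perm (Fin n)) :
    (δ n i : Gr n).coeff σ = if σ.cycleType = Multiset.replicate i 2 then 1 else 0 := by
  change (∑ τ : Perm (Fin n) with τ.cycleType = Multiset.replicate i 2, Gr.of τ).coeff σ = _
  rw [coeff_sum]
  simp [coeff_of]

theorem cycleType_of_coeff_delta_ne_zero {i : ℕ} {σ : Perm (Fin n)}
    (h : (δ n i : Gr n).coeff σ ≠ 0) : σ.cycleType = Multiset.replicate i 2 := by
  by_contra hc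
  rw [coeff_delta, if_neg hc] at h
  exact h rfl

theorem delta_mem_homog (n i : ℕ) : (δ n i : Gr n) ∈ homog n i :=
  ⟨(δ n i).2, fun _ h => N_of_cycleType (cycleType_of_coeff_delta_ne_zero h)⟩

/-- All permutations occurring in `δ n k` have weights of the same sign. -/
theorem weightSum_delta_ne_zero {k : ℕ} (hk : 2 * k ≤ n) : weightSum (δ n k : Gr n) ≠ 0 := by
  have hw : ∀ σ : Perm (Fin n), σ.cycleType = Multiset.replicate k 2 →
      0 < (-1) ^ (k + (n - 2 * k)) * weight σ := by
    intro σ hσ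
    have h1 : #(fixedPts σ) = n - 2 * k := by
      have h2 := card_fixedPts_add σ
      rw [← Perm.sum_cycleType, hσ] at h2
      simp only [Multiset.sum_replicate, smul_eq_mul] at h2
      omega
    rw [weight, weightAux, h1, N_of_cycleType hσ, mul_left_comm, ← mul_assoc ((-1 : ℚ) ^ _),
      ← mul_pow]
    have := lenProd_pos σ
    simp only [mul_neg, mul_one, neg_neg, one_pow]
    positivity
  obtain ⟨σ, hσ⟩ : ∃ σ : Perm (Fin n), σ.cycleType = Multiset.replicate k 2 := by
    rw [Perm.exists_with_cycleType_iff]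
    constructor
    · simpa [mul_comm] using hk
    · intro a ha
      rw [Multiset.eq_of_mem_replicate ha]
  have hpos : 0 < (-1) ^ (k + (n - 2 * k)) * weightSum (δ n k : Gr n) := by
    rw [weightSum_apply, Finset.mul_sum]
    refine Finset.sum_pos' (fun τ _ => ?_) ⟨σ, mem_univ _, ?_⟩
    · rw [coeff_delta]
      split_ifs with h
      · rw [one_mul]
        exact (hw τ h).le
      · simp
    · rw [coeff_delta, if_pos hσ, one_mul]
      exact hw σ hσ
  exact right_ne_zero_of_mul hpos.ne'

/-- A subalgebra that contains `δ n 1, …, δ n m` contains all invariant elements of norm at most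
`m`, as long as `2 * m ≤ n`. -/
theorem homog_le_of_delta_mem {m : ℕ} (hm : 2 * m ≤ n) (B : Subalgebra ℚ (Gr n))
    (hB : ∀ i, 1 ≤ i → i ≤ m → (δ n i : Gr n) ∈ B) {k : ℕ} (hk : k ≤ m) :
    homog n k ≤ Subalgebra.toSubmodule B := by
  induction k using Nat.strong_induction_on with
  | _ k ih =>
  rcases Nat.eq_zero_or_pos k with rfl | hpos
  · intro a ha
    have h1 : a = a.coeff 1 • (1 : Gr n) := by
      ext σ
      rw [coeff_smul, coeff_one]
      split_ifs with h
      · rw [h, mul_one]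
      · rw [mul_zero]
        by_contra hc
        exact h (N_eq_zero.mp (ha.2 σ hc))
    rw [h1]
    exact B.smul_mem (one_mem B) _
  · have hdec : decomposables n k ≤ Subalgebra.toSubmodule B := by
      refine Submodule.span_le.mpr ?_
      rintro _ ⟨i, j, hi, hj, hij, b, hb, rfl⟩
      exact B.mul_mem (ih i (by omega) (by omega) (cycleSum_mem_homog n i))
        (ih j (by omega) (by omega) hb)
    have hcyc : cycleSum n k ∈ Subalgebra.toSubmodule B := by
      obtain ⟨z, hz, w, hw, hzw⟩ := Submodule.mem_sup.mp (homog_le_sup hpos (delta_mem_homog n k))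
      obtain ⟨c, rfl⟩ := Submodule.mem_span_singleton.mp hw
      have hc : c ≠ 0 := by
        rintro rfl
        refine weightSum_delta_ne_zero (n := n) (k := k) (by omega) ?_
        rw [← hzw, zero_smul, add_zero, weightSum_decomposables (by omega) hz]
      refine ((Subalgebra.toSubmodule B).smul_mem_iff hc).mp ?_
      rw [← add_sub_cancel_left z (c • cycleSum n k), hzw]
      exact Submodule.sub_mem _ (hB k hpos hk) (hdec hz)
    exact (homog_le_sup hpos).trans
      (sup_le hdec ((Submodule.span_singleton_le_iff_mem _ _).mpr hcyc))

end Generators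

end NormGraded

end

theorem mainTheorem2 (d : ℕ) (hd : 1 ≤ d) :
    (∀ i : ℕ, 1 ≤ i → i ≤ d - 1 → NormGraded.δ (2 * d) i ∈ NormGraded.normLE (2 * d) (d - 1)) ∧
    ∀ x ∈ NormGraded.normLE (2 * d) (d - 1),
      x ∈ Algebra.adjoin ℚ {y | ∃ i : ℕ, 1 ≤ i ∧ i ≤ d - 1 ∧ y = NormGraded.δ (2 * d) i} := by
  open NormGraded in
  refine ⟨fun i _ hi σ hσ => ((delta_mem_homog (2 * d) i).2 σ hσ).trans_le hi, fun x hx => ?_⟩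
  set S : Set (A (2 * d)) := {y | ∃ i : ℕ, 1 ≤ i ∧ i ≤ d - 1 ∧ y = δ (2 * d) i}
  set B := (Algebra.adjoin ℚ S).map (A (2 * d)).val
  have hB : ∀ i, 1 ≤ i → i ≤ d - 1 → (δ (2 * d) i : Gr (2 * d)) ∈ B := fun i h1 h2 =>
    ⟨δ (2 * d) i, Algebra.subset_adjoin ⟨i, h1, h2, rfl⟩, rfl⟩
  have hmem : (x : Gr (2 * d)) ∈ Subalgebra.toSubmodule B := by
    refine mem_of_classSum_mem x.2 fun σ hσ => ?_
    exact homog_le_of_delta_mem (by omega) B hB (hx σ hσ) (classSum_mem_homog σ)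
  obtain ⟨y, hy, hyx⟩ := hmem
  rwa [Subtype.ext hyx] at hy
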